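/- Let $n\ge 1$ and let $D$ be a simple graph on $\{1,\dots,n\}$ with edge set $\{(i_1,j_1),\dots,(i_k,j_k)\}$. Denote by $K_{n,1}^{(i_1,j_1),\dots,(i_k,j_k)}$ the graph on $\{0,1,\dots,n\}$ with solid edges $(0,j)$, $1\le j\le n$, and with the edges of $D$ as dashed edges. Assume that every vertex $i\in\{1,\dots,n\}$ lies on at least one dashed edge. An isomorphism of two such graphs is a bijection of the vertices other than $0$ which carries the dashed edges of one graph bijectively onto those of the other; one such graph is contained in another if there is an injection of the vertices other than $0$ which carries dashed edges to dashed edges. For $0<\tau<1$ let $TL_\tau=TL_\tau\bigl(K_{n,1}^{(i_1,j_1),\dots,(i_k,j_k)}\bigr)$ be the unital associative $\mathbb{C}$-algebra with generators $p_0,p_1,\dots,p_n$ and relations $p_l^2=p_l$ for $0\le l\le n$; $p_ip_0p_i=\tau^2p_i$ and $p_0p_ip_0=\tau^2p_0$ for $1\le i\le n$; and, for $1\le i\ne j\le n$, $p_ip_j=p_jp_i$ if $(i,j)$ is a dashed edge and $p_ip_j=p_jp_i=0$ otherwise. Let $d(m)$ be the dimension of the linear span of all products of at most $m$ generators (including the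 empty product $1$). The algebra has linear growth if there are $c,C>0$ with $cm\le d(m)\le Cm$ for all large $m$, and exponential growth if there is $a>1$ with $d(m)\ge a^m$ for all large $m$. Then the following hold. (i) $TL_\tau$ is finite-dimensional if and only if the graph is isomorphic to $K_{n,1}^{(1,2),(1,3),\dots,(1,n)}$ or to $K_{3,1}^{(1,2),(1,3),(2,3)}$. (ii) $TL_\tau$ is infinite-dimensional of linear growth if and only if $n=4$ and the graph is not isomorphic to $K_{4,1}^{(1,2),(1,3),(1,4)}$. (iii) For every graph other than those described in (i) and (ii), $TL_\tau$ is infinite-dimensional of exponential growth, and the graph contains $K_{5,1}^{(1,2),(2,3),(4,5)}$, $K_{6,1}^{(1,6),(2,3),(4,5)}$ or $K_{5,1}^{(1,2),(1,4),(1,5),(2,3)}$. -/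

import Mathlib

open scoped SimpleGraph Asymptotics

namespace TLStar

/-- The dashed part of the two-coloured star `K_{n,1}^E`.  The solid edges join the centre `0` to
each of the leaves `1, …, n`, so the two-coloured graph is determined by `n` and by the simple
graph of dashed edges on the leaves.  Leaf number `k` is represented by the element of `Fin n` with
value `k - 1`; `E` is the list of dashed edges `(i₁,j₁), …, (i_k,j_k)`, as a set of pairs of labels,
read as unordered pairs. -/
def K (n : ℕ) (E : Set (ℕ × ℕ)) : SimpleGraph (Fin n) :=
  SimpleGraph.fromRel fun i j => ((i : ℕ) + 1, (j : ℕ) + 1) ∈ E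

/-- `K_{n,1}^{(1,2),(1,3),…,(1,n)}`. -/
def starK (n : ℕ) : SimpleGraph (Fin n) :=
  K n {e | e.1 = 1 ∧ 2 ≤ e.2 ∧ e.2 ≤ n}

/-- Generators: `none` is `p₀`, `some i` is the generator of the leaf `i`. -/
abbrev Gen (n : ℕ) : Type := Option (Fin n)

/-- The generator `p_k` in the free algebra. -/
noncomputable abbrev x {n : ℕ} (k : Gen n) : FreeAlgebra ℂ (Gen n) := FreeAlgebra.ι ℂ k

/-- Defining relations of `TL_τ` for the two-coloured star with dashed graph `D`. -/
inductive Rel {n : ℕ} (τ : ℝ) (D : SimpleGraph (Fin n)) :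
    FreeAlgebra ℂ (Gen n) → FreeAlgebra ℂ (Gen n) → Prop
  | idem (k : Gen n) : Rel τ D (x k * x k) (x k)
  | leaf (i : Fin n) : Rel τ D (x (some i) * x none * x (some i)) (((τ : ℂ) ^ 2) • x (some i))
  | centre (i : Fin n) : Rel τ D (x none * x (some i) * x none) (((τ : ℂ) ^ 2) • x none)
  | comm (i j : Fin n) (h : D.Adj i j) :
      Rel τ D (x (some i) * x (some j)) (x (some j) * x (some i))
  | orth (i j : Fin n) (hne : i ≠ j) (h : ¬ D.Adj i j) :
      Rel τ D (x (some i) * x (some j)) 0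

/-- The unital complex algebra `TL_τ`. -/
abbrev TL {n : ℕ} (τ : ℝ) (D : SimpleGraph (Fin n)) : Type := RingQuot (Rel τ D)

/-- The generator `p_k` of `TL_τ`. -/
noncomputable def p {n : ℕ} (τ : ℝ) (D : SimpleGraph (Fin n)) (k : Gen n) : TL τ D :=
  RingQuot.mkAlgHom ℂ (Rel τ D) (x k)

/-- The growth function of an algebra with respect to a set `S` of generators: the dimension of
the span of all products of at most `m` elements of `S` (the empty product being `1`). -/
noncomputable def growth {A : Type*} [Ring A] [Algebra ℂ A] (S : Set A) (m : ℕ) : ℕ :=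
  Module.finrank ℂ ↥((Submodule.span ℂ (insert 1 S)) ^ m : Submodule ℂ A)

/-- Linear growth: the growth function is bounded above and below, for all large `m`, by positive
multiples of `m`. -/
def HasLinearGrowth {n : ℕ} (τ : ℝ) (D : SimpleGraph (Fin n)) : Prop :=
  (fun m : ℕ => (growth (Set.range (p τ D)) m : ℝ)) =Θ[Filter.atTop] fun m : ℕ => (m : ℝ)

/-- Exponential growth: the growth function is at least `a ^ m` for some `a > 1` and all large `m`.
(It is always at most `(n + 2) ^ m`.) -/
def HasExponentialGrowth {n : ℕ} (τ : ℝ) (D : SimpleGraph (Fin n)) : Prop :=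
  ∃ a : ℝ, 1 < a ∧
    ∀ᶠ m : ℕ in Filter.atTop, a ^ m ≤ (growth (Set.range (p τ D)) m : ℝ)

end TLStar

/-! Everything depends on whether the dashed graph `D` has two disjoint edges.

Upper bounds. Up to leaf monomials on both sides, the algebra is spanned by the leaf monomials and
by products of the compressions `cornerMono c` of leaf monomials by `p₀`. A factor with at most one
leaf is a multiple of `p₀`. Two adjacent factors whose leaf sets meet merge, up to a scalar, into
that of the union, and a factor containing a non-adjacent pair vanishes. Hence only words whose
consecutive sets are disjoint and have at least two leaves matter. If all edges meet there are none
of length two (`finite_of_edges_meet`). On four leaves consecutive sets are complementary, so a word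
is given by its first set and its length (`growth_le_of_four`).

Lower bounds. Idempotents attached to edges, orthogonal whenever the edges share an end, can be
prescribed freely in a corner of a representation (`exists_corner`). An edge `de` gets a generic
rank one idempotent over a free algebra, and edges disjoint from it get diagonal idempotents.
Alternating words then become free words, hence independent (`linearIndependent_altWord`). One edge
disjoint from `de` gives at least linear growth, two give exponential growth.

Graph theory. Without isolated vertices, pairwise meeting edges form a star or a triangle
(`edgesMeet_iff`). Two disjoint edges and a fifth vertex give an edge disjoint from a two-edge path,
or three disjoint edges. -/

namespace TLStar

/-! ### Relations between the generators -/

section Generators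

variable {n : ℕ} (τ : ℝ) (D : SimpleGraph (Fin n))

theorem p_idem (k : Gen n) : p τ D k * p τ D k = p τ D k := by
  have h := RingQuot.mkAlgHom_rel ℂ (Rel.idem (τ := τ) (D := D) k)
  simpa [p] using h

theorem p_leaf (i : Fin n) :
    p τ D (some i) * p τ D none * p τ D (some i) = ((τ : ℂ) ^ 2) • p τ D (some i) := by
  have h := RingQuot.mkAlgHom_rel ℂ (Rel.leaf (τ := τ) (D := D) i)
  rwa [map_mul, map_mul, map_smul] at h

theorem p_centre (i : Fin n) :
    p τ D none * p τ D (some i) * p τ D none = ((τ : ℂ) ^ 2) • p τ D none := by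
  have h := RingQuot.mkAlgHom_rel ℂ (Rel.centre (τ := τ) (D := D) i)
  rwa [map_mul, map_mul, map_smul] at h

theorem p_orth {i j : Fin n} (hne : i ≠ j) (h : ¬ D.Adj i j) :
    p τ D (some i) * p τ D (some j) = 0 := by
  have h := RingQuot.mkAlgHom_rel ℂ (Rel.orth (τ := τ) (D := D) i j hne h)
  rwa [map_mul, map_zero] at h

theorem p_commute (i j : Fin n) : Commute (p τ D (some i)) (p τ D (some j)) := by
  rcases eq_or_ne i j with rfl | hne
  · exact Commute.refl _
  by_cases h : D.Adj i j
  · have h := RingQuot.mkAlgHom_rel ℂ (Rel.comm (τ := τ) (D := D) i j h)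
    rwa [map_mul, map_mul] at h
  · rw [Commute, SemiconjBy, p_orth τ D hne h, p_orth τ D hne.symm (fun h' => h h'.symm)]

/-- A family of elements satisfying the defining relations gives a homomorphism from `TL`. -/
theorem exists_lift {B : Type*} [Ring B] [Algebra ℂ B] (f : Gen n → B)
    (idem : ∀ k, f k * f k = f k)
    (leaf : ∀ i, f (some i) * f none * f (some i) = ((τ : ℂ) ^ 2) • f (some i))
    (centre : ∀ i, f none * f (some i) * f none = ((τ : ℂ) ^ 2) • f none)
    (comm : ∀ i j, D.Adj i j → f (some i) * f (some j) = f (some j) * f (some i))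
    (orth : ∀ i j, i ≠ j → ¬ D.Adj i j → f (some i) * f (some j) = 0) :
    ∃ φ : TL τ D →ₐ[ℂ] B, ∀ k, φ (p τ D k) = f k := by
  refine ⟨RingQuot.liftAlgHom ℂ ⟨FreeAlgebra.lift ℂ f, ?_⟩, fun k => ?_⟩
  · intro a b h
    induction h with
    | idem k => simpa using idem k
    | leaf i => simpa using leaf i
    | centre i => simpa using centre i
    | comm i j h => simpa using comm i j h
    | orth i j hne h => simpa using orth i j hne h
  · rw [p, RingQuot.liftAlgHom_mkAlgHom_apply, FreeAlgebra.lift_ι_apply]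

theorem adjoin_range_p : Algebra.adjoin ℂ (Set.range (p τ D)) = ⊤ := by
  have h : Set.range (p τ D) =
      Set.image (RingQuot.mkAlgHom ℂ (Rel τ D)) (Set.range (FreeAlgebra.ι ℂ)) := by
    rw [← Set.range_comp]; rfl
  rw [h, ← AlgHom.map_adjoin, FreeAlgebra.adjoin_range_ι, Algebra.map_top,
    AlgHom.range_eq_top]
  exact RingQuot.mkAlgHom_surjective ℂ _

end Generators

/-! ### Matrix representations -/

section Rep

variable {R σ : Type*} [Ring R]

/-- The matrix representing a leaf, for a partition of unity `d` into orthogonal idempotents. -/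
def leafMatrix [DecidableEq σ] (d : σ → R) : Matrix (Option σ) (Option σ) R
  | none, _ => 0
  | some s, none => d s
  | some s, some t => if s = t then d s else 0

/-- The matrix representing the centre. -/
noncomputable def centreMatrix (σ R : Type*) [Ring R] [Algebra ℂ R] (c : ℂ) :
    Matrix (Option σ) (Option σ) R
  | none, none => 1
  | none, some _ => algebraMap ℂ R c
  | some _, _ => 0

/-- The compression to the range of `centreMatrix`. -/
noncomputable def corner [Algebra ℂ R] [Fintype σ] (c : ℂ) :
    Matrix (Option σ) (Option σ) R →ₗ[ℂ] R where
  toFun X := X none none + ∑ s, algebraMap ℂ R c * X (some s) none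
  map_add' X Y := by simp [mul_add, Finset.sum_add_distrib]; abel
  map_smul' a X := by simp [Finset.smul_sum]

theorem leafMatrix_mul [Fintype σ] [DecidableEq σ] (d d' : σ → R) :
    leafMatrix d * leafMatrix d' = leafMatrix (d * d') := by
  ext s t
  rcases s with _ | s <;> rcases t with _ | t <;>
    simp [Matrix.mul_apply, Fintype.sum_option, leafMatrix]
  split_ifs <;> simp_all

theorem centreMatrix_idem [Algebra ℂ R] [Fintype σ] (c : ℂ) :
    centreMatrix σ R c * centreMatrix σ R c = centreMatrix σ R c := by
  ext s t
  rcases s with _ | s <;> rcases t with _ | t <;>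
    simp [Matrix.mul_apply, Fintype.sum_option, centreMatrix]

/-- The centre is the rank one product of a column and a row, so the left side is an outer product
of `d` with itself. Orthogonality of the `d s` makes its block on `σ` diagonal again. -/
theorem leafMatrix_centre_leafMatrix [Algebra ℂ R] [Fintype σ] [DecidableEq σ] (c : ℂ) {d : σ → R}
    (hd : ∀ s t, d s * d t = if s = t then d s else 0) (h1 : ∑ s, d s = 1) :
    leafMatrix d * centreMatrix σ R c * leafMatrix d = c • leafMatrix d := by
  ext s t
  rcases s with _ | s <;> rcases t with _ | t <;>
    simp [Matrix.mul_apply, Fintype.sum_option, centreMatrix, leafMatrix]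
  · rw [← Finset.mul_sum, h1, mul_one, Algebra.smul_def, Algebra.commutes]
  · rw [mul_assoc, Algebra.commutes, ← mul_assoc, hd]
    split_ifs <;> simp [Algebra.smul_def, Algebra.commutes]

theorem centre_leafMatrix_centre [Algebra ℂ R] [Fintype σ] [DecidableEq σ] (c : ℂ)
    {d : σ → R} (h1 : ∑ s, d s = 1) :
    centreMatrix σ R c * leafMatrix d * centreMatrix σ R c = c • centreMatrix σ R c := by
  ext s t
  rcases s with _ | s <;> rcases t with _ | t <;>
    simp [Matrix.mul_apply, Fintype.sum_option, centreMatrix, leafMatrix]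
  · rw [← Finset.mul_sum, h1, mul_one, Algebra.smul_def, mul_one]
  · rw [← Finset.mul_sum, h1, mul_one, Algebra.smul_def]

/-- With `v` the row `(1, c, …, c)` and `e` the `none` column, the centre is `e * v` and `corner X`
is `v * X * e`. The product therefore splits at the centre. -/
theorem corner_mul_centre_mul [Algebra ℂ R] [Fintype σ] (c : ℂ)
    (X Y : Matrix (Option σ) (Option σ) R) :
    corner c (X * centreMatrix σ R c * Y) = corner c X * corner c Y := by
  have key : ∀ s, (X * centreMatrix σ R c * Y) s none = X s none * corner c Y := by
    intro s
    simp [Matrix.mul_apply, Fintype.sum_option, centreMatrix, corner, mul_add, Finset.mul_sum,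
      mul_assoc]
  simp only [corner, LinearMap.coe_mk, AddHom.coe_mk] at key ⊢
  simp only [key, add_mul, Finset.sum_mul, mul_assoc]

theorem corner_leafMatrix [Algebra ℂ R] [Fintype σ] [DecidableEq σ] (c : ℂ) (d : σ → R) :
    corner c (leafMatrix d) = c • ∑ s, d s := by
  simp [corner, leafMatrix, ← Finset.mul_sum, Algebra.smul_def]

end Rep

/-- Idempotents attached to edges of `D`, orthogonal whenever the edges share an end, are realized
by the corner of a representation of `TL`. -/
theorem exists_corner {n : ℕ} {τ : ℝ} {D : SimpleGraph (Fin n)} {R O : Type*} [Ring R]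
    [Algebra ℂ R] [Fintype O] [DecidableEq O] (e : O → Sym2 (Fin n)) (he : ∀ o, e o ∈ D.edgeSet)
    (hinj : Function.Injective e) (u : O → R)
    (hu : ∀ i o o', i ∈ e o → i ∈ e o' → u o * u o' = if o = o' then u o else 0) :
    ∃ ρ : TL τ D →ₗ[ℂ] R,
      (∀ X Y, ρ (X * p τ D none * Y) = ρ X * ρ Y) ∧
      ∀ o i j, e o = s(i, j) → ρ (p τ D (some i) * p τ D (some j)) = ((τ : ℂ) ^ 2) • u o := by
  classical
  -- Each leaf gets a partition of unity: `u o` in the slot of every edge `o` through it, and the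
  -- remainder `r i` in a slot private to `i`. Two distinct leaves thus overlap only in the slot of
  -- an edge joining them, so their product depends only on the unordered pair and is zero if that
  -- pair is not some `e o`.
  let r : Fin n → R := fun i => 1 - ∑ o, if i ∈ e o then u o else 0
  let d : Fin n → (O ⊕ Fin n) → R := fun i =>
    Sum.elim (fun o => if i ∈ e o then u o else 0) (fun k => if k = i then r i else 0)
  have hur : ∀ i o, i ∈ e o → u o * r i = 0 := by
    intro i o ho
    simp only [r, mul_sub, mul_one, Finset.mul_sum, mul_ite, mul_zero]
    rw [Finset.sum_eq_single o]
    · simp [ho, hu i o o ho ho]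
    · intro o' _ hne
      split_ifs with h
      · simp [hu i o o' ho h, hne.symm]
      · rfl
    · simp
  have hru : ∀ i o, i ∈ e o → r i * u o = 0 := by
    intro i o ho
    simp only [r, sub_mul, one_mul, Finset.sum_mul, ite_mul, zero_mul]
    rw [Finset.sum_eq_single o]
    · simp [ho, hu i o o ho ho]
    · intro o' _ hne
      split_ifs with h
      · simp [hu i o' o h ho, hne]
      · rfl
    · simp
  have hrr : ∀ i, r i * r i = r i := by
    intro i
    conv_lhs => rw [show r i * r i = r i * (1 - ∑ o, if i ∈ e o then u o else 0) from rfl]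
    rw [mul_sub, mul_one, Finset.mul_sum, sub_eq_self]
    refine Finset.sum_eq_zero fun o _ => ?_
    split_ifs with h
    · exact hru i o h
    · simp
  have hd1 : ∀ i, ∑ s, d i s = 1 := by
    intro i
    simp [d, r]
  have hdd : ∀ i s t, d i s * d i t = if s = t then d i s else 0 := by
    rintro i (o | k) (o' | k')
    · by_cases h : i ∈ e o <;> by_cases h' : i ∈ e o'
      · simp [d, h, h', hu i o o' h h']
      · have : o ≠ o' := by rintro rfl; exact h' h
        simp [d, h, h', this]
      · have : o ≠ o' := by rintro rfl; exact h h'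
        simp [d, h, h', this]
      · simp [d, h, h']
    · by_cases h : i ∈ e o <;> by_cases h' : k' = i <;> simp [d, h, h', hur]
    · by_cases h : i ∈ e o' <;> by_cases h' : k = i <;> simp [d, h, h', hru]
    · by_cases h : k = i <;> by_cases h' : k' = i
      · subst h; subst h'; simp [d, hrr]
      · have : i ≠ k' := fun hk => h' hk.symm
        simp [d, h, h', this]
      · simp [d, h]
      · simp [d, h]
  have hdij : ∀ i j, i ≠ j → d i * d j =
      Sum.elim (fun o => if e o = s(i, j) then u o else 0) (fun _ => 0) := by
    intro i j hij
    funext s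
    rcases s with o | k
    · by_cases h : e o = s(i, j)
      · have hi : i ∈ e o := by simp [h]
        have hj : j ∈ e o := by simp [h]
        have := hu i o o hi hi
        simp only [if_true] at this
        simp only [Pi.mul_apply, d, Sum.elim_inl, if_pos hi, if_pos hj, if_pos h, this]
      · have : ¬ (i ∈ e o ∧ j ∈ e o) := fun h' => h ((Sym2.mem_and_mem_iff hij).1 h')
        by_cases hi : i ∈ e o
        · have hj : j ∉ e o := fun hj => this ⟨hi, hj⟩
          simp [d, hj, h]
        · simp [d, hi, h]
    · by_cases h : k = i
      · have : k ≠ j := by rintro rfl; exact hij h.symm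
        simp [d, this]
      · simp [d, h]
  obtain ⟨φ, hφ⟩ := exists_lift τ D
    (fun k : Gen n => k.elim (centreMatrix (O ⊕ Fin n) R ((τ : ℂ) ^ 2)) fun i => leafMatrix (d i))
    (by
      rintro (_ | i)
      · exact centreMatrix_idem _
      · simp only [Option.elim_some, leafMatrix_mul]
        congr 1
        funext s
        simp [hdd])
    (fun i => leafMatrix_centre_leafMatrix _ (hdd i) (hd1 i))
    (fun i => centre_leafMatrix_centre _ (hd1 i))
    (by
      intro i j h
      simp only [Option.elim_some, leafMatrix_mul]
      rw [hdij i j h.ne, hdij j i h.ne', Sym2.eq_swap])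
    (by
      intro i j hne h
      simp only [Option.elim_some, leafMatrix_mul]
      rw [hdij i j hne]
      have : ∀ o, e o ≠ s(i, j) := by
        intro o ho
        have := he o
        rw [ho] at this
        exact h this
      ext s t
      rcases s with _ | s | s <;> rcases t with _ | t <;> simp [leafMatrix, this])
  refine ⟨corner ((τ : ℂ) ^ 2) ∘ₗ φ.toLinearMap, ?_, ?_⟩
  · intro X Y
    simp only [LinearMap.comp_apply, AlgHom.toLinearMap_apply, map_mul, hφ, Option.elim_none]
    exact corner_mul_centre_mul _ _ _
  · intro o i j ho
    have hij : i ≠ j := by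
      have := he o
      rw [ho] at this
      exact D.ne_of_adj this
    simp only [LinearMap.comp_apply, AlgHom.toLinearMap_apply, map_mul, hφ, Option.elim_some]
    rw [leafMatrix_mul, corner_leafMatrix, hdij i j hij]
    congr 1
    simp only [Fintype.sum_sum_type, Sum.elim_inl, Sum.elim_inr, Finset.sum_const_zero, add_zero]
    rw [Finset.sum_eq_single o]
    · simp [ho]
    · intro o' _ hne
      rw [if_neg]
      intro h
      exact hne (hinj (h.trans ho.symm))
    · simp

end TLStar

namespace TLStar

/-! ### Idempotent matrices over a free algebra -/

section Free

variable {A : Type*} [Fintype A]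

/-- The row vector whose entries are the free generators and their complement to `1`. -/
noncomputable def freeRow (A : Type*) [Fintype A] : Option A → FreeAlgebra ℂ A
  | none => 1 - ∑ a, FreeAlgebra.ι ℂ a
  | some a => FreeAlgebra.ι ℂ a

/-- This normalization makes the matrix with all rows equal to `freeRow A` idempotent, and lets
`rowSum` remove the last factor in `freeAlt_apply`. -/
theorem sum_freeRow : ∑ b, freeRow A b = 1 := by
  simp [Fintype.sum_option, freeRow]

variable [DecidableEq A]

/-- A rank one idempotent together with the diagonal idempotents, over a free algebra. -/
noncomputable def freeIdem : Option A → Matrix (Option A) (Option A) (FreeAlgebra ℂ A)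
  | none => Matrix.of fun _ j => freeRow A j
  | some a => Matrix.diagonal (Pi.single (some a) 1)

theorem freeIdem_none_mul (X : Matrix (Option A) (Option A) (FreeAlgebra ℂ A))
    (i j : Option A) :
    (freeIdem (none : Option A) * X) i j = ∑ b, freeRow A b * X b j := by
  simp [freeIdem, Matrix.mul_apply]

theorem freeIdem_none_idem : freeIdem (none : Option A) * freeIdem none = freeIdem none := by
  ext i j
  rw [freeIdem_none_mul]
  simp only [freeIdem, Matrix.of_apply]
  rw [← Finset.sum_mul, sum_freeRow, one_mul]

theorem freeIdem_some_mul (a b : A) :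
    freeIdem (some a) * freeIdem (some b) = if a = b then freeIdem (some a) else 0 := by
  simp only [freeIdem, Matrix.diagonal_mul_diagonal]
  split_ifs with h
  · subst h
    congr 1
    funext i
    by_cases hi : i = some a
    · subst hi; simp
    · simp [hi]
  · rw [← Matrix.diagonal_zero]
    congr 1
    funext i
    by_cases hi : i = some a
    · subst hi; simp [h]
    · simp [hi]

/-- The alternating product of `freeIdem none` and the `freeIdem (some a)`, `a ∈ l`. -/
noncomputable def freeAlt : List A → Matrix (Option A) (Option A) (FreeAlgebra ℂ A)
  | [] => freeIdem none
  | a :: l => freeIdem none * freeIdem (some a) * freeAlt l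

/-- All rows of `freeIdem none` coincide, so inserting the diagonal idempotent at `a` just extracts
the entry `a` of the row, a free generator. -/
theorem freeAlt_apply (l : List A) (i j : Option A) :
    freeAlt l i j = (l.map (FreeAlgebra.ι ℂ)).prod * freeRow A j := by
  induction l generalizing i with
  | nil => simp [freeAlt, freeIdem]
  | cons a l ih =>
    rw [freeAlt, mul_assoc, freeIdem_none_mul, Finset.sum_eq_single (some a)]
    · simp [freeIdem, Matrix.diagonal_mul, freeRow, ih, mul_assoc]
    · intro b _ hb
      simp [freeIdem, Matrix.diagonal_mul, hb]
    · simp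

/-- The sum of the entries in one row. -/
noncomputable def rowSum :
    Matrix (Option A) (Option A) (FreeAlgebra ℂ A) →ₗ[ℂ] FreeAlgebra ℂ A where
  toFun X := ∑ j, X none j
  map_add' X Y := by simp [Finset.sum_add_distrib]
  map_smul' a X := by simp [Finset.smul_sum]

theorem rowSum_freeAlt (l : List A) :
    rowSum (freeAlt l) = (l.map (FreeAlgebra.ι ℂ)).prod := by
  simp only [rowSum, LinearMap.coe_mk, AddHom.coe_mk, freeAlt_apply]
  rw [← Finset.mul_sum, sum_freeRow, mul_one]

end Free

theorem linearIndependent_freeWords (A : Type*) :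
    LinearIndependent ℂ fun l : List A => (l.map (FreeAlgebra.ι ℂ)).prod := by
  have h := (FreeAlgebra.basisFreeMonoid ℂ A).linearIndependent.comp (FreeMonoid.ofList (α := A))
    FreeMonoid.ofList.injective
  have e : (fun l : List A => (l.map (FreeAlgebra.ι ℂ)).prod) =
      FreeAlgebra.basisFreeMonoid ℂ A ∘ FreeMonoid.ofList := by
    funext l
    simp only [Function.comp_apply, FreeAlgebra.basisFreeMonoid, Module.Basis.map_apply]
    simp [FreeAlgebra.equivMonoidAlgebraFreeMonoid, MonoidAlgebra.lift_single,
      FreeMonoid.lift_apply]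
  rw [e]
  exact h

/-! ### Lower bounds for the growth -/

section Lower

variable {n : ℕ} {τ : ℝ} {D : SimpleGraph (Fin n)}

/-- The span of the products of at most `m` generators. -/
noncomputable abbrev words (τ : ℝ) (D : SimpleGraph (Fin n)) (m : ℕ) : Submodule ℂ (TL τ D) :=
  (Submodule.span ℂ (insert 1 (Set.range (p τ D)))) ^ m

instance finite_words (m : ℕ) : Module.Finite ℂ (words τ D m) :=
  Module.Finite.iff_fg.2
    (Submodule.FG.pow (Submodule.fg_span ((Set.finite_range _).insert _)) m)

theorem one_le_words_one :
    (1 : Submodule ℂ (TL τ D)) ≤ Submodule.span ℂ (insert 1 (Set.range (p τ D))) := by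
  rw [Submodule.one_le]
  exact Submodule.subset_span (Set.mem_insert _ _)

theorem words_mono {m m' : ℕ} (h : m ≤ m') : words τ D m ≤ words τ D m' :=
  pow_le_pow_right' one_le_words_one h

theorem growth_mono {m m' : ℕ} (h : m ≤ m') :
    growth (Set.range (p τ D)) m ≤ growth (Set.range (p τ D)) m' :=
  Submodule.finrank_mono (words_mono h)

theorem p_mul_mem_words {m : ℕ} {y : TL τ D} (k : Gen n) (hy : y ∈ words τ D m) :
    p τ D k * y ∈ words τ D (m + 1) := by
  rw [words, pow_succ']
  exact Submodule.mul_mem_mul (Submodule.subset_span (Set.mem_insert_of_mem _ ⟨k, rfl⟩)) hy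

/-- The alternating word of the edge `s(d, e)` and the edges `s(l a, r a)`. -/
noncomputable def altWord {A : Type*} (τ : ℝ) (D : SimpleGraph (Fin n)) (d e : Fin n)
    (l r : A → Fin n) : List A → TL τ D
  | [] => p τ D (some d) * p τ D (some e)
  | a :: w => p τ D (some d) * p τ D (some e) * p τ D none *
      (p τ D (some (l a)) * p τ D (some (r a))) * p τ D none * altWord τ D d e l r w

/-- Each letter costs six generators, and the final edge costs two. -/
theorem altWord_mem_words {A : Type*} (d e : Fin n) (l r : A → Fin n) (w : List A) :
    altWord τ D d e l r w ∈ words τ D (6 * w.length + 2) := by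
  induction w with
  | nil =>
    have : altWord τ D d e l r [] = p τ D (some d) * (p τ D (some e) * 1) := by
      rw [mul_one, altWord]
    rw [this]
    refine p_mul_mem_words _ (p_mul_mem_words _ ?_)
    rw [words, List.length_nil, mul_zero, pow_zero]
    exact Submodule.one_le.1 le_rfl
  | cons a w ih =>
    simp only [altWord, mul_assoc]
    exact p_mul_mem_words _ (p_mul_mem_words _ (p_mul_mem_words _ (p_mul_mem_words _
      (p_mul_mem_words _ (p_mul_mem_words _ ih)))))

theorem linearIndependent_altWord {A : Type*} [Fintype A] [DecidableEq A] (hτ : τ ≠ 0)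
    {d e : Fin n} {l r : A → Fin n} (hde : D.Adj d e) (hlr : ∀ a, D.Adj (l a) (r a))
    (hinj : Function.Injective fun a => s(l a, r a))
    (hdisj : ∀ a i, i ∈ s(l a, r a) → i ∉ s(d, e)) :
    LinearIndependent ℂ (altWord τ D d e l r) := by
  let ed : Option A → Sym2 (Fin n) := fun o => o.elim s(d, e) fun a => s(l a, r a)
  obtain ⟨ρ, hmul, hρ⟩ := exists_corner (τ := τ) (D := D) ed
    (by rintro (_ | a); exacts [hde, hlr a])
    (by
      rintro (_ | a) (_ | b) h
      · rfl
      · have h : s(d, e) = s(l b, r b) := h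
        exact absurd (Sym2.mem_mk_left d e) (hdisj b d (h ▸ Sym2.mem_mk_left d e))
      · have h : s(l a, r a) = s(d, e) := h
        exact absurd (Sym2.mem_mk_left d e) (hdisj a d (h ▸ Sym2.mem_mk_left d e))
      · exact congrArg some (hinj h))
    freeIdem
    (by
      rintro i (_ | a) (_ | b) h h'
      · simpa using freeIdem_none_idem
      · exact absurd h (hdisj b i h')
      · exact absurd h' (hdisj a i h)
      · simpa using freeIdem_some_mul a b)
  -- Each edge factor contributes `τ ^ 2`: there are `w.length + 1` copies of `de` and `w.length`
  -- other edges.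
  have hval : ∀ w, ρ (altWord τ D d e l r w) =
      (((τ : ℂ) ^ 2) ^ (2 * w.length + 1)) • freeAlt w := by
    intro w
    induction w with
    | nil => simpa [altWord, freeAlt] using hρ none d e rfl
    | cons a w ih =>
      rw [altWord, hmul, hmul, hρ none d e rfl, hρ (some a) _ _ rfl, ih, freeAlt]
      simp only [smul_mul_assoc, mul_smul_comm, smul_smul, List.length_cons]
      congr 1
      ring
  have hc : ((τ : ℂ) ^ 2) ≠ 0 := by simpa using hτ
  refine LinearIndependent.of_comp (rowSum ∘ₗ ρ) ?_
  have := (linearIndependent_freeWords A).units_smul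
    fun w => Units.mk0 (((τ : ℂ) ^ 2) ^ (2 * w.length + 1)) (pow_ne_zero _ hc)
  convert this using 1
  funext w
  simp only [Function.comp_apply, LinearMap.comp_apply, hval, map_smul, rowSum_freeAlt,
    Pi.smul_apply']
  rfl

theorem card_le_growth {A ι : Type*} [Fintype ι] {d e : Fin n} {l r : A → Fin n}
    (h : LinearIndependent ℂ (altWord τ D d e l r)) {f : ι → List A} (hf : Function.Injective f)
    {k : ℕ} (hk : ∀ i, (f i).length ≤ k) :
    Fintype.card ι ≤ growth (Set.range (p τ D)) (6 * k + 2) := by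
  have hmem : ∀ i, altWord τ D d e l r (f i) ∈ words τ D (6 * k + 2) := fun i =>
    words_mono (by have := hk i; omega) (altWord_mem_words d e l r (f i))
  have hli : LinearIndependent ℂ
      (fun i => (⟨altWord τ D d e l r (f i), hmem i⟩ : words τ D (6 * k + 2))) := by
    refine LinearIndependent.of_comp (words τ D (6 * k + 2)).subtype ?_
    exact h.comp f hf
  exact hli.fintype_card_le_finrank

/-- Two disjoint edges make the growth at least linear. -/
theorem le_growth_of_disjoint_edges (hτ : τ ≠ 0) {a b d e : Fin n} (hab : D.Adj a b)
    (hde : D.Adj d e) (h1 : a ≠ d) (h2 : a ≠ e) (h3 : b ≠ d) (h4 : b ≠ e) (k : ℕ) :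
    k ≤ growth (Set.range (p τ D)) (6 * k + 2) := by
  have h := linearIndependent_altWord (A := Unit) (l := fun _ => a) (r := fun _ => b) hτ hde
    (fun _ => hab) (fun _ _ _ => rfl) (by
      intro _ i hi hi'
      rw [Sym2.mem_iff] at hi hi'
      rcases hi with rfl | rfl <;> rcases hi' with h | h <;> contradiction)
  simpa using card_le_growth h (ι := Fin k) (f := fun i => List.replicate i ())
    (fun i j hij => by simpa [Fin.ext_iff] using congrArg List.length hij) (k := k)
    (fun i => by simp)

theorem not_finite_of_disjoint_edges (hτ : τ ≠ 0) {a b d e : Fin n} (hab : D.Adj a b)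
    (hde : D.Adj d e) (h1 : a ≠ d) (h2 : a ≠ e) (h3 : b ≠ d) (h4 : b ≠ e) :
    ¬ FiniteDimensional ℂ (TL τ D) := by
  intro hfin
  have h := le_growth_of_disjoint_edges hτ hab hde h1 h2 h3 h4 (Module.finrank ℂ (TL τ D) + 1)
  have h' : growth (Set.range (p τ D)) (6 * (Module.finrank ℂ (TL τ D) + 1) + 2) ≤
    Module.finrank ℂ (TL τ D) := Submodule.finrank_le _
  omega

/-- An edge disjoint from two distinct edges makes the growth exponential. -/
theorem hasExponentialGrowth_of_edges (hτ : τ ≠ 0) {d e : Fin n} {l r : Bool → Fin n}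
    (hde : D.Adj d e) (hlr : ∀ a, D.Adj (l a) (r a))
    (hne : s(l false, r false) ≠ s(l true, r true))
    (hdisj : ∀ a, l a ≠ d ∧ l a ≠ e ∧ r a ≠ d ∧ r a ≠ e) :
    HasExponentialGrowth τ D := by
  have h := linearIndependent_altWord (A := Bool) hτ hde hlr
    (by
      rintro (_ | _) (_ | _) hab
      · rfl
      · exact absurd hab hne
      · exact absurd hab.symm hne
      · rfl)
    (by
      intro a i hi hi'
      obtain ⟨h1, h2, h3, h4⟩ := hdisj a
      rw [Sym2.mem_iff] at hi hi'
      rcases hi with rfl | rfl <;> rcases hi' with h | h <;> contradiction)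
  have hk : ∀ k, 2 ^ k ≤ growth (Set.range (p τ D)) (6 * k + 2) := by
    intro k
    simpa using card_le_growth h (ι := Fin k → Bool) (f := List.ofFn) List.ofFn_injective (k := k)
      (fun i => by simp)
  -- Length `m` accommodates all binary words of length `(m - 2) / 6`, which is at least `m / 12`
  -- once `m ≥ 14`.
  refine ⟨2 ^ (1 / 12 : ℝ), Real.one_lt_rpow (by norm_num) (by norm_num), ?_⟩
  filter_upwards [Filter.eventually_ge_atTop 14] with m hm
  have h1 : m ≤ 12 * ((m - 2) / 6) := by omega
  have h2 : 6 * ((m - 2) / 6) + 2 ≤ m := by omega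
  calc ((2 : ℝ) ^ (1 / 12 : ℝ)) ^ m ≤ ((2 : ℝ) ^ (1 / 12 : ℝ)) ^ (12 * ((m - 2) / 6)) :=
        pow_le_pow_right₀ (Real.one_le_rpow (by norm_num) (by norm_num)) h1
    _ = (2 : ℝ) ^ ((m - 2) / 6) := by
        rw [pow_mul, ← Real.rpow_natCast ((2 : ℝ) ^ (1 / 12 : ℝ)), ← Real.rpow_mul (by norm_num)]
        norm_num
    _ ≤ growth (Set.range (p τ D)) m := by
        exact_mod_cast (hk _).trans (growth_mono h2)

end Lower

end TLStar

namespace TLStar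

/-! ### Upper bounds for the growth -/

section Upper

variable {n : ℕ} (τ : ℝ) (D : SimpleGraph (Fin n))

/-- The product of the leaf generators in `c`. -/
noncomputable def mono (c : Finset (Fin n)) : TL τ D :=
  c.noncommProd (fun i => p τ D (some i)) fun i _ j _ _ => p_commute τ D i j

theorem mono_empty : mono τ D ∅ = 1 := Finset.noncommProd_empty _ _

theorem p_mul_mono (i : Fin n) (c : Finset (Fin n)) :
    p τ D (some i) * mono τ D c = mono τ D (insert i c) := by
  have key : ∀ b : Finset (Fin n), i ∉ b →
      mono τ D (insert i b) = p τ D (some i) * mono τ D b := fun b hb =>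
    Finset.noncommProd_insert_of_notMem _ _ _ _ hb
  by_cases hi : i ∈ c
  · rw [Finset.insert_eq_of_mem hi, ← Finset.insert_erase hi, key _ (Finset.notMem_erase i c),
      ← mul_assoc, p_idem]
  · exact (key c hi).symm

theorem mono_singleton (i : Fin n) : mono τ D {i} = p τ D (some i) :=
  Finset.noncommProd_singleton _ _

theorem mono_mul_mono (c c' : Finset (Fin n)) :
    mono τ D c * mono τ D c' = mono τ D (c ∪ c') := by
  induction c using Finset.induction_on with
  | empty => simp [mono_empty]
  | insert i c _ ih =>
    rw [← p_mul_mono, mul_assoc, ih, p_mul_mono, Finset.insert_union]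

/-- A common leaf `i` can be moved next to `p₀` from both sides, where `p_i p₀ p_i = τ² p_i` removes
the centre. -/
theorem mono_centre_mono {c c' : Finset (Fin n)} {i : Fin n} (hi : i ∈ c) (hi' : i ∈ c') :
    mono τ D c * p τ D none * mono τ D c' = ((τ : ℂ) ^ 2) • mono τ D (c ∪ c') := by
  have h1 : mono τ D c = mono τ D c * p τ D (some i) := by
    rw [← mono_singleton, mono_mul_mono, Finset.union_singleton, Finset.insert_eq_of_mem hi]
  have h2 : mono τ D c' = p τ D (some i) * mono τ D c' := by
    rw [p_mul_mono, Finset.insert_eq_of_mem hi']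
  calc mono τ D c * p τ D none * mono τ D c'
      = mono τ D c * (p τ D (some i) * p τ D none * p τ D (some i)) * mono τ D c' := by
        conv_lhs => rw [h1, h2]
        simp only [mul_assoc]
    _ = ((τ : ℂ) ^ 2) • mono τ D (c ∪ c') := by
        rw [p_leaf, mul_smul_comm, smul_mul_assoc, ← h1, mono_mul_mono]

theorem mono_eq_zero {c : Finset (Fin n)} {i j : Fin n} (hi : i ∈ c) (hj : j ∈ c) (hne : i ≠ j)
    (h : ¬ D.Adj i j) : mono τ D c = 0 := by
  rw [← Finset.insert_eq_of_mem hi, ← p_mul_mono, ← Finset.insert_eq_of_mem hj, ← p_mul_mono,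
    ← mul_assoc, p_orth τ D hne h, zero_mul]

/-- The compression of `mono c` by the central generator. -/
noncomputable def cornerMono (c : Finset (Fin n)) : TL τ D :=
  p τ D none * mono τ D c * p τ D none

theorem cornerMono_empty : cornerMono τ D ∅ = p τ D none := by
  rw [cornerMono, mono_empty, mul_one, p_idem]

theorem centre_mul_cornerMono (c : Finset (Fin n)) :
    p τ D none * cornerMono τ D c = cornerMono τ D c := by
  rw [cornerMono, ← mul_assoc, ← mul_assoc, p_idem]

theorem cornerMono_mul_centre (c : Finset (Fin n)) :
    cornerMono τ D c * p τ D none = cornerMono τ D c := by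
  rw [cornerMono, mul_assoc, p_idem]

theorem exists_cornerMono_eq_smul {c : Finset (Fin n)} (hc : c.card ≤ 1) :
    ∃ a : ℂ, cornerMono τ D c = a • p τ D none := by
  rcases Nat.le_one_iff_eq_zero_or_eq_one.1 hc with h | h
  · rw [Finset.card_eq_zero] at h
    exact ⟨1, by rw [h, cornerMono_empty, one_smul]⟩
  · obtain ⟨i, rfl⟩ := Finset.card_eq_one.1 h
    exact ⟨_, by rw [cornerMono, mono_singleton, p_centre]⟩

theorem cornerMono_mul_cornerMono {c c' : Finset (Fin n)} (h : ¬ Disjoint c c') :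
    cornerMono τ D c * cornerMono τ D c' = ((τ : ℂ) ^ 2) • cornerMono τ D (c ∪ c') := by
  obtain ⟨i, hi, hi'⟩ := Finset.not_disjoint_iff.1 h
  calc cornerMono τ D c * cornerMono τ D c'
      = p τ D none * (mono τ D c * (p τ D none * p τ D none) * mono τ D c') * p τ D none := by
        simp only [cornerMono, mul_assoc]
    _ = _ := by
        rw [p_idem, mono_centre_mono τ D hi hi', mul_smul_comm, smul_mul_assoc, cornerMono]

/-- The span of the leaf monomials and of their products with `Q` from both sides. -/
noncomputable def spread (Q : Submodule ℂ (TL τ D)) : Submodule ℂ (TL τ D) :=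
  Submodule.span ℂ (Set.range (mono τ D) ∪ {y | ∃ a, ∃ q ∈ Q, ∃ b, mono τ D a * q * mono τ D b = y})

theorem spread_le_span {ι : Type*} (G : ι → TL τ D) {Q : Submodule ℂ (TL τ D)}
    (hQ : Q ≤ Submodule.span ℂ (Set.range G)) :
    spread τ D Q ≤ Submodule.span ℂ (Set.range
      (Sum.elim (mono τ D) fun t : Finset (Fin n) × ι × Finset (Fin n) =>
        mono τ D t.1 * G t.2.1 * mono τ D t.2.2)) := by
  refine Submodule.span_le.2 ?_
  rintro y (⟨c, rfl⟩ | ⟨a, q, hq, b, rfl⟩)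
  · exact Submodule.subset_span ⟨Sum.inl c, rfl⟩
  · replace hq := hQ hq
    rw [SetLike.mem_coe]
    induction hq using Submodule.span_induction with
    | mem q hq =>
      obtain ⟨i, rfl⟩ := hq
      exact Submodule.subset_span ⟨Sum.inr (a, i, b), rfl⟩
    | zero => simp
    | add q q' _ _ h h' => rw [mul_add, add_mul]; exact add_mem h h'
    | smul z q _ h => rw [mul_smul_comm, smul_mul_assoc]; exact Submodule.smul_mem _ _ h

/-- A leaf generator is absorbed by the left monomial. The centre, meeting `mono a * q` with `q = p₀
q`, turns it into `cornerMono a * q`. -/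
theorem p_mul_mem_spread {Q Q' : Submodule ℂ (TL τ D)} (hQ : Q ≤ Q') (h0 : p τ D none ∈ Q')
    (hp : ∀ q ∈ Q, p τ D none * q = q) (hE : ∀ c, ∀ q ∈ Q, cornerMono τ D c * q ∈ Q')
    (k : Gen n) {y : TL τ D} (hy : y ∈ spread τ D Q) : p τ D k * y ∈ spread τ D Q' := by
  induction hy using Submodule.span_induction with
  | zero => simp
  | add q q' _ _ h h' => rw [mul_add]; exact add_mem h h'
  | smul z q _ h => rw [mul_smul_comm]; exact Submodule.smul_mem _ _ h
  | mem y hy =>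
    refine Submodule.subset_span ?_
    rcases hy with ⟨c, rfl⟩ | ⟨a, q, hq, b, rfl⟩ <;> rcases k with _ | i
    · exact Or.inr ⟨∅, _, h0, c, by rw [mono_empty, one_mul]⟩
    · exact Or.inl ⟨_, (p_mul_mono τ D i c).symm⟩
    · refine Or.inr ⟨∅, _, hE a q hq, b, ?_⟩
      rw [mono_empty, one_mul, cornerMono, mul_assoc _ _ q, hp q hq]
      simp only [mul_assoc]
    · refine Or.inr ⟨insert i a, q, hQ hq, b, ?_⟩
      rw [← p_mul_mono]
      simp only [mul_assoc]

theorem one_mem_spread (Q : Submodule ℂ (TL τ D)) : 1 ∈ spread τ D Q :=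
  Submodule.subset_span (Or.inl ⟨∅, mono_empty τ D⟩)

theorem spread_mono {Q Q' : Submodule ℂ (TL τ D)} (h : Q ≤ Q') : spread τ D Q ≤ spread τ D Q' :=
  Submodule.span_mono (Set.union_subset_union_right _ fun _ ⟨a, q, hq, b, hy⟩ =>
    ⟨a, q, h hq, b, hy⟩)

/-- If no two edges are disjoint, the algebra is finite-dimensional. -/
theorem finite_of_edges_meet
    (hD : ∀ a b d e, D.Adj a b → D.Adj d e → a = d ∨ a = e ∨ b = d ∨ b = e) :
    FiniteDimensional ℂ (TL τ D) := by
  let Q : Submodule ℂ (TL τ D) := Submodule.span ℂ (Set.range (cornerMono τ D))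
  have hc : ∀ c, cornerMono τ D c ∈ Q := fun c => Submodule.subset_span ⟨c, rfl⟩
  have hz : ∀ c, 1 < c.card → (∃ i ∈ c, ∃ j ∈ c, D.Adj i j) ∨ cornerMono τ D c = 0 := by
    intro c h
    obtain ⟨i, hi, j, hj, hij⟩ := Finset.one_lt_card.1 h
    by_cases hadj : D.Adj i j
    · exact Or.inl ⟨i, hi, j, hj, hadj⟩
    · exact Or.inr (by rw [cornerMono, mono_eq_zero τ D hi hj hij hadj, mul_zero, zero_mul])
  -- `Q` is closed under multiplication: disjoint sets with at least two leaves each would either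
  -- contain disjoint edges or give a zero factor.
  have hmul : ∀ c c', cornerMono τ D c * cornerMono τ D c' ∈ Q := by
    intro c c'
    by_cases hdis : Disjoint c c'
    · rcases le_or_gt c.card 1 with h | h
      · obtain ⟨a, ha⟩ := exists_cornerMono_eq_smul τ D h
        rw [ha, smul_mul_assoc, centre_mul_cornerMono]
        exact Q.smul_mem _ (hc _)
      rcases le_or_gt c'.card 1 with h' | h'
      · obtain ⟨a, ha⟩ := exists_cornerMono_eq_smul τ D h'
        rw [ha, mul_smul_comm, cornerMono_mul_centre]
        exact Q.smul_mem _ (hc _)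
      rcases hz c h with ⟨i, hi, j, hj, hij⟩ | h0
      · rcases hz c' h' with ⟨k, hk, l, hl, hkl⟩ | h0
        · have hne := Finset.disjoint_left.1 hdis
          rcases hD i j k l hij hkl with rfl | rfl | rfl | rfl
          · exact absurd hk (hne hi)
          · exact absurd hl (hne hi)
          · exact absurd hk (hne hj)
          · exact absurd hl (hne hj)
        · rw [h0, mul_zero]; exact Q.zero_mem
      · rw [h0, zero_mul]; exact Q.zero_mem
    · rw [cornerMono_mul_cornerMono τ D hdis]
      exact Q.smul_mem _ (hc _)
  have h0 : p τ D none ∈ Q := cornerMono_empty τ D ▸ hc ∅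
  have hp : ∀ q ∈ Q, p τ D none * q = q := by
    intro q hq
    induction hq using Submodule.span_induction with
    | mem q hq => obtain ⟨c, rfl⟩ := hq; exact centre_mul_cornerMono τ D c
    | zero => simp
    | add q q' _ _ h h' => rw [mul_add, h, h']
    | smul z q _ h => rw [mul_smul_comm, h]
  have hE : ∀ c, ∀ q ∈ Q, cornerMono τ D c * q ∈ Q := by
    intro c q hq
    induction hq using Submodule.span_induction with
    | mem q hq => obtain ⟨c', rfl⟩ := hq; exact hmul c c'
    | zero => simp
    | add q q' _ _ h h' => rw [mul_add]; exact add_mem h h'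
    | smul z q _ h => rw [mul_smul_comm]; exact Submodule.smul_mem _ _ h
  have htop : (⊤ : Submodule ℂ (TL τ D)) ≤ spread τ D Q := by
    rw [← Algebra.top_toSubmodule, ← adjoin_range_p τ D, Algebra.adjoin_eq_span]
    refine Submodule.span_le.2 fun y hy => ?_
    induction hy using Submonoid.closure_induction_left with
    | one => exact one_mem_spread τ D Q
    | mul_left g hg y _ ih =>
      obtain ⟨k, rfl⟩ := hg
      exact p_mul_mem_spread τ D le_rfl h0 hp hE k ih
  have hfin := top_unique (htop.trans (spread_le_span τ D (cornerMono τ D) le_rfl))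
  exact ⟨hfin ▸ Submodule.fg_span (Set.finite_range _)⟩

end Upper

/-! ### Linear upper bound on four leaves -/

section Four

variable (τ : ℝ) (D : SimpleGraph (Fin 4))

/-- The alternating product of length `k` of the compressions of `mono c` and `mono cᶜ`. -/
noncomputable def complAlt : Finset (Fin 4) → ℕ → TL τ D
  | _, 0 => p τ D none
  | c, k + 1 => cornerMono τ D c * complAlt cᶜ k

/-- The span of the alternating products of length at most `m`. -/
noncomputable def complSpan (m : ℕ) : Submodule ℂ (TL τ D) :=
  Submodule.span ℂ (Set.range fun t : Finset (Fin 4) × Fin (m + 1) => complAlt τ D t.1 t.2)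

theorem complAlt_mem_complSpan (c : Finset (Fin 4)) {k m : ℕ} (h : k ≤ m) :
    complAlt τ D c k ∈ complSpan τ D m :=
  Submodule.subset_span ⟨(c, ⟨k, Nat.lt_succ_of_le h⟩), rfl⟩

theorem complSpan_mono {m m' : ℕ} (h : m ≤ m') : complSpan τ D m ≤ complSpan τ D m' := by
  refine Submodule.span_le.2 ?_
  rintro _ ⟨⟨c, k⟩, rfl⟩
  exact complAlt_mem_complSpan τ D c ((Nat.lt_succ_iff.1 k.2).trans h)

theorem centre_mul_complAlt (c : Finset (Fin 4)) (k : ℕ) :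
    p τ D none * complAlt τ D c k = complAlt τ D c k := by
  cases k with
  | zero => exact p_idem τ D none
  | succ k => rw [complAlt, ← mul_assoc, centre_mul_cornerMono]

/-- If `b` meets `c`, the first two factors merge and induction applies; a factor with at most one
leaf drops out. In the remaining case `b` is the complement of `c`, and the alternating word gets
longer by one. -/
theorem cornerMono_mul_complAlt (b c : Finset (Fin 4)) (k : ℕ) :
    cornerMono τ D b * complAlt τ D c k ∈ complSpan τ D (k + 1) := by
  induction k generalizing b c with
  | zero => exact complAlt_mem_complSpan τ D b (k := 1) le_rfl
  | succ k ih =>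
    by_cases hdis : Disjoint b c
    · rcases le_or_gt b.card 1 with h | h
      · obtain ⟨a, ha⟩ := exists_cornerMono_eq_smul τ D h
        rw [ha, smul_mul_assoc, centre_mul_complAlt]
        exact Submodule.smul_mem _ _ (complAlt_mem_complSpan τ D c (by omega))
      rcases le_or_gt c.card 1 with h' | h'
      · obtain ⟨a, ha⟩ := exists_cornerMono_eq_smul τ D h'
        rw [complAlt, ha, smul_mul_assoc, mul_smul_comm, centre_mul_complAlt]
        exact Submodule.smul_mem _ _ (complSpan_mono τ D (by omega) (ih b cᶜ))
      have hb : b = cᶜ := by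
        refine Finset.eq_of_subset_of_card_le (Finset.subset_compl_iff_disjoint_right.2 hdis) ?_
        rw [Finset.card_compl, Fintype.card_fin]
        omega
      have := complAlt_mem_complSpan τ D b (le_refl (k + 2))
      rwa [complAlt, hb, compl_compl, ← hb] at this
    · rw [complAlt, ← mul_assoc, cornerMono_mul_cornerMono τ D hdis, smul_mul_assoc]
      exact Submodule.smul_mem _ _ (complSpan_mono τ D (by omega) (ih _ _))

theorem words_le_spread (m : ℕ) : words τ D m ≤ spread τ D (complSpan τ D m) := by
  have hp : ∀ m, ∀ q ∈ complSpan τ D m, p τ D none * q = q := by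
    intro m q hq
    induction hq using Submodule.span_induction with
    | mem q hq => obtain ⟨t, rfl⟩ := hq; exact centre_mul_complAlt τ D _ _
    | zero => simp
    | add q q' _ _ h h' => rw [mul_add, h, h']
    | smul z q _ h => rw [mul_smul_comm, h]
  have hE : ∀ m c, ∀ q ∈ complSpan τ D m, cornerMono τ D c * q ∈ complSpan τ D (m + 1) := by
    intro m c q hq
    induction hq using Submodule.span_induction with
    | mem q hq =>
      obtain ⟨⟨c', k⟩, rfl⟩ := hq
      exact complSpan_mono τ D (by have := k.2; omega)
        (cornerMono_mul_complAlt τ D c c' k)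
    | zero => simp
    | add q q' _ _ h h' => rw [mul_add]; exact add_mem h h'
    | smul z q _ h => rw [mul_smul_comm]; exact Submodule.smul_mem _ _ h
  induction m with
  | zero =>
    rw [words, pow_zero, Submodule.one_le]
    exact one_mem_spread τ D _
  | succ m ih =>
    rw [words, pow_succ']
    refine Submodule.mul_le.2 fun x hx y hy => ?_
    induction hx using Submodule.span_induction with
    | mem x hx =>
      rcases hx with rfl | ⟨k, rfl⟩
      · rw [one_mul]
        exact spread_mono τ D (complSpan_mono τ D m.le_succ) (ih hy)
      · exact p_mul_mem_spread τ D (complSpan_mono τ D m.le_succ)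
          (complAlt_mem_complSpan τ D ∅ (Nat.zero_le _)) (hp m) (hE m) k (ih hy)
    | zero => simp
    | add q q' _ _ h h' => rw [add_mul]; exact add_mem h h'
    | smul z q _ h => rw [smul_mul_assoc]; exact Submodule.smul_mem _ _ h

/-- There are 16 leaf monomials, and `16 * (16 * (m + 1)) * 16` products of a monomial, an
alternating word and a monomial. -/
theorem growth_le_of_four (m : ℕ) : growth (Set.range (p τ D)) m ≤ 16 + 4096 * (m + 1) := by
  have h := (words_le_spread τ D m).trans (spread_le_span τ D _ le_rfl)
  have := Module.Finite.span_of_finite ℂ (Set.finite_range (Sum.elim (mono τ D)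
    fun t : Finset (Fin 4) × (Finset (Fin 4) × Fin (m + 1)) × Finset (Fin 4) =>
      mono τ D t.1 * complAlt τ D t.2.1.1 t.2.1.2 * mono τ D t.2.2))
  have h1 := Submodule.finrank_mono h
  refine h1.trans ((finrank_range_le_card _).trans ?_)
  simp
  omega

end Four

end TLStar

namespace TLStar

/-! ### Graphs without disjoint edges -/

section Combinatorics

/-- Any two edges have a common end. -/
def EdgesMeet {n : ℕ} (D : SimpleGraph (Fin n)) : Prop :=
  ∀ a b d e, D.Adj a b → D.Adj d e → a = d ∨ a = e ∨ b = d ∨ b = e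

theorem starK_adj {n : ℕ} (i j : Fin n) :
    (starK n).Adj i j ↔ i ≠ j ∧ ((i : ℕ) = 0 ∨ (j : ℕ) = 0) := by
  simp only [starK, K, SimpleGraph.fromRel_adj, Set.mem_ofPred_eq, ne_eq, Fin.ext_iff]
  omega

theorem starK_four : starK 4 = K 4 {(1, 2), (1, 3), (1, 4)} := by
  ext i j
  simp only [starK_adj, K, SimpleGraph.fromRel_adj, Set.mem_insert_iff, Set.mem_singleton_iff,
    Prod.mk.injEq, ne_eq, Fin.ext_iff]
  omega

theorem K_three_eq_top : K 3 {(1, 2), (1, 3), (2, 3)} = ⊤ := by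
  ext i j
  simp only [K, SimpleGraph.fromRel_adj, SimpleGraph.top_adj, Set.mem_insert_iff,
    Set.mem_singleton_iff, Prod.mk.injEq, ne_eq, Fin.ext_iff]
  omega

theorem nonempty_iso_starK {n : ℕ} {D : SimpleGraph (Fin n)} (a : Fin n)
    (h : ∀ i j, D.Adj i j ↔ i ≠ j ∧ (i = a ∨ j = a)) : Nonempty (D ≃g starK n) := by
  have : NeZero n := ⟨by rintro rfl; exact a.elim0⟩
  refine ⟨⟨Equiv.swap a 0, ?_⟩⟩
  have h0 : ∀ i, ((Equiv.swap a 0 i : Fin n) : ℕ) = 0 ↔ i = a := by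
    intro i
    rw [Fin.val_eq_zero_iff, Equiv.swap_apply_eq_iff, Equiv.swap_apply_right]
  intro i j
  rw [starK_adj, h, h0, h0, (Equiv.swap a 0).injective.ne_iff]

theorem edgesMeet_iff {n : ℕ} {D : SimpleGraph (Fin n)} (hD : ∀ i, ∃ j, D.Adj i j) :
    EdgesMeet D ↔
      Nonempty (D ≃g starK n) ∨ Nonempty (D ≃g K 3 {(1, 2), (1, 3), (2, 3)}) := by
  constructor
  · intro h
    -- With no leaves, the empty graph is itself `starK 0`.
    rcases Nat.eq_zero_or_pos n with rfl | hn
    · exact Or.inl ⟨⟨Equiv.refl _, fun {i} => i.elim0⟩⟩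
    have star : ∀ a, (∀ i j, D.Adj i j → i = a ∨ j = a) → Nonempty (D ≃g starK n) := by
      intro a ha
      have hadj : ∀ i, i ≠ a → D.Adj i a := by
        intro i hi
        obtain ⟨j, hj⟩ := hD i
        rcases ha i j hj with rfl | rfl
        · exact absurd rfl hi
        · exact hj
      refine nonempty_iso_starK a fun i j => ⟨fun hij => ⟨hij.ne, ha i j hij⟩, ?_⟩
      rintro ⟨hne, rfl | rfl⟩
      · exact (hadj j hne.symm).symm
      · exact hadj i hne
    obtain ⟨b, hab⟩ := hD ⟨0, hn⟩
    set a : Fin n := ⟨0, hn⟩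
    by_cases hA : ∀ i j, D.Adj i j → i = a ∨ j = a
    · exact Or.inl (star a hA)
    by_cases hB : ∀ i j, D.Adj i j → i = b ∨ j = b
    · exact Or.inl (star b hB)
    -- If neither end of the edge `ab` covers all edges, some edge at `b` avoids `a` and some edge
    -- at `a` avoids `b`. These two must meet, which closes a triangle.
    have key : ∀ a b, D.Adj a b → (¬ ∀ i j, D.Adj i j → i = a ∨ j = a) →
        ∃ c, c ≠ a ∧ D.Adj b c := by
      intro a b hab hA
      push Not at hA
      obtain ⟨i, j, hij, hi, hj⟩ := hA
      rcases h a b i j hab hij with rfl | rfl | rfl | rfl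
      · exact absurd rfl hi
      · exact absurd rfl hj
      · exact ⟨j, hj, hij⟩
      · exact ⟨i, hi, hij.symm⟩
    obtain ⟨c, hca, hbc⟩ := key a b hab hA
    obtain ⟨c', hcb, hac⟩ := key b a hab.symm hB
    have hcc : c = c' := by
      rcases h b c a c' hbc hac with h1 | h1 | h1 | h1
      · exact absurd h1 hab.ne'
      · exact absurd h1.symm hcb
      · exact absurd h1 hca
      · exact h1
    subst hcc
    -- An edge from a vertex off the triangle would need its other end on all three sides at once.
    have hall : ∀ v, v = a ∨ v = b ∨ v = c := by
      intro v
      by_contra! hv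
      obtain ⟨h1, h2, h3⟩ := hv
      obtain ⟨w, hvw⟩ := hD v
      have e1 := h v w a b hvw hab
      have e2 := h v w b c hvw hbc
      have e3 := h v w a c hvw hac
      have := hab.ne
      have := hbc.ne
      have := hac.ne
      grind
    have hn3 : n = 3 := by
      have hu : (Finset.univ : Finset (Fin n)) = {a, b, c} := by
        ext v
        simpa using hall v
      have := congrArg Finset.card hu
      rw [Finset.card_univ, Fintype.card_fin,
        Finset.card_eq_three.2 ⟨a, b, c, hab.ne, hac.ne, hbc.ne, rfl⟩] at this
      exact this
    have htop : D = ⊤ := by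
      ext v w
      refine ⟨fun h => h.ne, fun hne => ?_⟩
      have hne : v ≠ w := hne
      rcases hall v with rfl | rfl | rfl <;> rcases hall w with rfl | rfl | rfl <;>
        first | exact absurd rfl hne | assumption | (apply SimpleGraph.Adj.symm; assumption)
    clear_value a
    subst hn3
    rw [K_three_eq_top, htop]
    exact Or.inr ⟨SimpleGraph.Iso.refl⟩
  · rintro (⟨⟨f⟩⟩ | ⟨⟨f⟩⟩) a b d e hab hde
    · rw [← f.map_adj_iff, starK_adj] at hab hde
      have hinj := f.injective
      obtain ⟨-, hab⟩ := hab
      obtain ⟨-, hde⟩ := hde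
      rcases hab with h1 | h1 <;> rcases hde with h2 | h2 <;>
        have := hinj (Fin.ext (h1.trans h2.symm)) <;> tauto
    · have hab := (f.map_adj_iff.2 hab).ne
      have hde := (f.map_adj_iff.2 hde).ne
      by_contra! hne
      obtain ⟨h1, h2, h3, h4⟩ := hne
      have h1 := f.injective.ne h1
      have h2 := f.injective.ne h2
      have h3 := f.injective.ne h3
      have h4 := f.injective.ne h4
      rw [Ne, Fin.ext_iff] at *
      omega

theorem path_edge_isContained {n : ℕ} {D : SimpleGraph (Fin n)} {a b c d e : Fin n}
    (hab : D.Adj a b) (hbc : D.Adj b c) (hde : D.Adj d e) (hnd : [a, b, c, d, e].Nodup) :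
    K 5 {(1, 2), (2, 3), (4, 5)} ⊑ D := by
  refine ⟨⟨⟨![a, b, c, d, e], ?_⟩, ?_⟩⟩
  · intro i j hij
    fin_cases i <;> fin_cases j <;> simp [K] at hij ⊢ <;>
      first | assumption | (apply SimpleGraph.Adj.symm; assumption)
  · exact List.nodup_ofFn.1 (by simpa using hnd)

theorem matching_isContained {n : ℕ} {D : SimpleGraph (Fin n)} {a b c d e f : Fin n}
    (haf : D.Adj a f) (hbc : D.Adj b c) (hde : D.Adj d e) (hnd : [a, b, c, d, e, f].Nodup) :
    K 6 {(1, 6), (2, 3), (4, 5)} ⊑ D := by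
  refine ⟨⟨⟨![a, b, c, d, e, f], ?_⟩, ?_⟩⟩
  · intro i j hij
    fin_cases i <;> fin_cases j <;> simp [K] at hij ⊢ <;>
      first | assumption | (apply SimpleGraph.Adj.symm; assumption)
  · exact List.nodup_ofFn.1 (by simpa using hnd)

/-- A graph without isolated vertices on more than four vertices, with two disjoint edges, has an
edge disjoint from a path with two edges, or three disjoint edges. -/
theorem exists_path_edge_or_matching {n : ℕ} {D : SimpleGraph (Fin n)}
    (hD : ∀ i, ∃ j, D.Adj i j) (h : ¬ EdgesMeet D) (hn : n ≠ 4) :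
    (∃ a b c d e, D.Adj a b ∧ D.Adj b c ∧ D.Adj d e ∧ [a, b, c, d, e].Nodup) ∨
      ∃ a b c d e f, D.Adj a f ∧ D.Adj b c ∧ D.Adj d e ∧ [a, b, c, d, e, f].Nodup := by
  simp only [EdgesMeet] at h
  push Not at h
  obtain ⟨a, b, d, e, hab, hde, h1, h2, h3, h4⟩ := h
  have hcard : ({a, b, d, e} : Finset (Fin n)).card = 4 := by
    have := hab.ne
    have := hde.ne
    rw [Finset.card_insert_of_notMem, Finset.card_eq_three.2 ⟨b, d, e, h3, h4, hde.ne, rfl⟩]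
    simp [*]
  -- As `n ≠ 4`, some vertex `v` lies off both edges. If its neighbour `w` is on one of them, a
  -- two-edge path disjoint from the other edge appears; otherwise there are three disjoint edges.
  obtain ⟨v, hv⟩ : ∃ v, v ∉ ({a, b, d, e} : Finset (Fin n)) := by
    by_contra! hall
    have : ({a, b, d, e} : Finset (Fin n)) = Finset.univ := Finset.eq_univ_iff_forall.2 hall
    rw [this, Finset.card_univ, Fintype.card_fin] at hcard
    exact hn hcard
  simp only [Finset.mem_insert, Finset.mem_singleton, not_or] at hv
  obtain ⟨v1, v2, v3, v4⟩ := hv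
  obtain ⟨w, hvw⟩ := hD v
  have hne1 := hab.ne
  have hne2 := hde.ne
  have hne3 := hvw.ne
  by_cases wa : w = a
  · subst wa
    exact Or.inl ⟨v, w, b, d, e, hvw, hab, hde, by simp; tauto⟩
  by_cases wb : w = b
  · subst wb
    exact Or.inl ⟨v, w, a, d, e, hvw, hab.symm, hde, by simp; tauto⟩
  by_cases wd : w = d
  · subst wd
    exact Or.inl ⟨v, w, e, a, b, hvw, hde, hab, by simp; tauto⟩
  by_cases we : w = e
  · subst we
    exact Or.inl ⟨v, w, d, a, b, hvw, hde.symm, hab, by simp; tauto⟩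
  · exact Or.inr ⟨v, a, b, d, e, w, hvw, hab, hde, by simp; tauto⟩

end Combinatorics

/-! ### Growth types -/

section Growth

variable {n : ℕ} {τ : ℝ} {D : SimpleGraph (Fin n)}

theorem HasExponentialGrowth.not_hasLinearGrowth (h : HasExponentialGrowth τ D) :
    ¬ HasLinearGrowth τ D := by
  obtain ⟨a, ha, hev⟩ := h
  intro hlin
  have h1 : (fun m : ℕ => a ^ m) =O[Filter.atTop] fun m : ℕ => (m : ℝ) := by
    refine Asymptotics.IsBigO.trans (Asymptotics.IsBigO.of_bound 1 ?_) hlin.1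
    filter_upwards [hev] with m hm
    rw [one_mul, Real.norm_of_nonneg (by positivity), Real.norm_of_nonneg (by positivity)]
    exact hm
  have h2 := h1.trans_isLittleO (isLittleO_coe_const_pow_of_one_lt ha)
  refine Asymptotics.isLittleO_irrefl (Filter.Eventually.frequently ?_) h2
  exact Filter.Eventually.of_forall fun m => by positivity

theorem not_finite_of_not_edgesMeet (hτ : τ ≠ 0) (h : ¬ EdgesMeet D) :
    ¬ FiniteDimensional ℂ (TL τ D) := by
  simp only [EdgesMeet] at h
  push Not at h
  obtain ⟨a, b, d, e, hab, hde, h1, h2, h3, h4⟩ := h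
  exact not_finite_of_disjoint_edges hτ hab hde h1 h2 h3 h4

theorem hasLinearGrowth_of_four {D : SimpleGraph (Fin 4)} (hτ : τ ≠ 0) (h : ¬ EdgesMeet D) :
    HasLinearGrowth τ D := by
  simp only [EdgesMeet] at h
  push Not at h
  obtain ⟨a, b, d, e, hab, hde, h1, h2, h3, h4⟩ := h
  constructor
  -- For `m ≥ 1`, `16 + 4096 * (m + 1)` is at most `8208 * m`.
  · refine Asymptotics.IsBigO.of_bound 8208 ?_
    filter_upwards [Filter.eventually_ge_atTop 1] with m hm
    rw [Real.norm_of_nonneg (by positivity), Real.norm_of_nonneg (by positivity)]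
    have := growth_le_of_four τ D m
    exact_mod_cast (by omega : growth (Set.range (p τ D)) m ≤ 8208 * m)
  · refine Asymptotics.IsBigO.of_bound 12 ?_
    filter_upwards [Filter.eventually_ge_atTop 14] with m hm
    rw [Real.norm_of_nonneg (by positivity), Real.norm_of_nonneg (by positivity)]
    have := (le_growth_of_disjoint_edges hτ hab hde h1 h2 h3 h4 ((m - 2) / 6)).trans
      (growth_mono (by omega : 6 * ((m - 2) / 6) + 2 ≤ m))
    exact_mod_cast (by omega : m ≤ 12 * growth (Set.range (p τ D)) m)

/-- In both configurations `de` is disjoint from two distinct other edges, as the exponential bound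
requires. -/
theorem exponential_and_contained (hτ : τ ≠ 0) (hD : ∀ i, ∃ j, D.Adj i j) (h : ¬ EdgesMeet D)
    (hn : n ≠ 4) :
    HasExponentialGrowth τ D ∧
      (K 5 {(1, 2), (2, 3), (4, 5)} ⊑ D ∨ K 6 {(1, 6), (2, 3), (4, 5)} ⊑ D) := by
  rcases exists_path_edge_or_matching hD h hn with
    ⟨a, b, c, d, e, hab, hbc, hde, hnd⟩ | ⟨a, b, c, d, e, f, haf, hbc, hde, hnd⟩
  · refine ⟨?_, Or.inl (path_edge_isContained hab hbc hde hnd)⟩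
    simp only [List.nodup_cons, List.mem_cons, List.not_mem_nil, or_false, not_or] at hnd
    refine hasExponentialGrowth_of_edges (l := fun t => bif t then a else b)
      (r := fun t => bif t then b else c) hτ hde ?_ ?_ ?_
    · rintro (_ | _)
      exacts [hbc, hab]
    · simp only [cond_false, cond_true, ne_eq, Sym2.eq_iff]
      tauto
    · rintro (_ | _) <;> simp only [cond_false, cond_true] <;> tauto
  · refine ⟨?_, Or.inr (matching_isContained haf hbc hde hnd)⟩
    simp only [List.nodup_cons, List.mem_cons, List.not_mem_nil, or_false, not_or] at hnd
    refine hasExponentialGrowth_of_edges (l := fun t => bif t then a else b)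
      (r := fun t => bif t then f else c) hτ hde ?_ ?_ ?_
    · rintro (_ | _)
      exacts [hbc, haf]
    · simp only [cond_false, cond_true, ne_eq, Sym2.eq_iff]
      tauto
    · rintro (_ | _) <;> simp only [cond_false, cond_true, ne_eq] <;> grind

end Growth

end TLStar

theorem mainTheorem1 (n : ℕ) (D : SimpleGraph (Fin n)) (hD : ∀ i : Fin n, ∃ j : Fin n, D.Adj i j)
    (τ : ℝ) (hτ0 : 0 < τ) (hτ1 : τ < 1) :
    (FiniteDimensional ℂ (TLStar.TL τ D) ↔
      (Nonempty (D ≃g TLStar.starK n) ∨ Nonempty (D ≃g TLStar.K 3 {(1, 2), (1, 3), (2, 3)}))) ∧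
    ((¬ FiniteDimensional ℂ (TLStar.TL τ D) ∧ TLStar.HasLinearGrowth τ D) ↔
      (n = 4 ∧ ¬ Nonempty (D ≃g TLStar.K 4 {(1, 2), (1, 3), (1, 4)}))) ∧
    (¬ (Nonempty (D ≃g TLStar.starK n) ∨ Nonempty (D ≃g TLStar.K 3 {(1, 2), (1, 3), (2, 3)})) →
      ¬ (n = 4 ∧ ¬ Nonempty (D ≃g TLStar.K 4 {(1, 2), (1, 3), (1, 4)})) →
      (¬ FiniteDimensional ℂ (TLStar.TL τ D) ∧ TLStar.HasExponentialGrowth τ D) ∧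
      (TLStar.K 5 {(1, 2), (2, 3), (4, 5)} ⊑ D ∨
        TLStar.K 6 {(1, 6), (2, 3), (4, 5)} ⊑ D ∨
        TLStar.K 5 {(1, 2), (1, 4), (1, 5), (2, 3)} ⊑ D)) := by
  have hτ : τ ≠ 0 := hτ0.ne'
  have hfin : FiniteDimensional ℂ (TLStar.TL τ D) ↔ TLStar.EdgesMeet D :=
    ⟨fun h => by_contra fun h' => TLStar.not_finite_of_not_edgesMeet hτ h' h,
      TLStar.finite_of_edges_meet τ D⟩
  have hfour : n = 4 → (TLStar.EdgesMeet D ↔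
      Nonempty (D ≃g TLStar.K 4 {(1, 2), (1, 3), (1, 4)})) := by
    rintro rfl
    rw [TLStar.edgesMeet_iff hD, ← TLStar.starK_four]
    refine ⟨?_, Or.inl⟩
    rintro (h | ⟨⟨f⟩⟩)
    · exact h
    · simpa using Fintype.card_congr f.toEquiv
  rw [← TLStar.edgesMeet_iff hD, hfin]
  refine ⟨Iff.rfl, ⟨?_, ?_⟩, ?_⟩
  · rintro ⟨h, hlin⟩
    have hn : n = 4 := by
      by_contra hn
      exact (TLStar.exponential_and_contained hτ hD h hn).1.not_hasLinearGrowth hlin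
    exact ⟨hn, fun h' => h ((hfour hn).2 h')⟩
  · rintro ⟨hn, h⟩
    rw [← hfour hn] at h
    subst hn
    exact ⟨h, TLStar.hasLinearGrowth_of_four hτ h⟩
  · intro h h4
    have hn : n ≠ 4 := fun hn => h4 ⟨hn, fun h' => h ((hfour hn).2 h')⟩
    obtain ⟨h1, h2⟩ := TLStar.exponential_and_contained hτ hD h hn
    -- The third graph is never needed: its edge `(2,3)` is disjoint from its path `4, 1, 5`, so it
    -- contains the first.
    exact ⟨⟨h, h1⟩, h2.imp_right Or.inl⟩
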